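/- Let $p$ be a prime, let $\mathcal L_G$ be the language of rings with an additional unary predicate $G$, and let $\mathrm{ACF}_G$ be the $\mathcal L_G$-theory of algebraically closed fields of characteristic $p$ in which $G$ is an additive subgroup. Let $\mathrm{ACFG}$ be the model companion of $\mathrm{ACF}_G$, given concretely as the common first-order theory of all existentially closed models of $\mathrm{ACF}_G$. Let $\mathrm{Sg}(\overline{\mathbb F_p})$ be the set of additive subgroups of $\overline{\mathbb F_p}$ with the Chabauty topology, i.e. the coarsest topology in which $\{H : x\in H\}$ is clopen for every $x\in\overline{\mathbb F_p}$; equivalently, the topology generated by the sets $\{H : H\cap \mathbb F_{p^n}=H_0\}$, where $n\ge 1$ and $H_0$ is a subgroup of $\mathbb F_{p^n}$. Then: 1. The set $\mathcal C=\{G\in \mathrm{Sg}(\overline{\mathbb F_p}) : (\overline{\mathbb F_p},G)\models \mathrm{ACFG}\}$ is a dense $G_\delta$ in $\mathrm{Sg}(\overline{\mathbb F_p})$. 2. For every $n\ge 1$ and every additive subgroup $G_0$ of $\mathbb F_{p^n}\subseteq\overline{\mathbb F_p}$ there is an additive subgroup $G$ of $\overline{\mathbb F_p}$ with $G\cap\mathbb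 F_{p^n}=G_0$ and $(\overline{\mathbb F_p},G)\models\mathrm{ACFG}$. 3. Every $\mathcal L_G$-theory $T$ that is a model companion of $\mathrm{ACF}_G$ (that is, $T$ is model complete, every model of $\mathrm{ACF}_G$ embeds in a model of $T$, and every model of $T$ embeds in a model of $\mathrm{ACF}_G$) has exactly the same models as $\mathrm{ACFG}$. -/

import Mathlib

open FirstOrder FirstOrder.Language

namespace ACFG

/-! ### Existentially closed models and model companions (countable languages, small structures)

For a countable language it makes no difference, by the Löwenheim–Skolem theorem, that the
structures below range over `Type`. -/

section ModelTheory

variable {L : FirstOrder.Language.{0, 0}}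

/-- `M` is an existentially closed model of `T`: it is a model of `T`, and whenever `M` embeds in a
model `N` of `T`, every quantifier-free formula with parameters in `M` that has a
solution in `N` has a solution in `M`. -/
def IsECModel (T : L.Theory) (M : Type) [L.Structure M] : Prop :=
  M ⊨ T ∧
    ∀ (N : Type) [L.Structure N], N ⊨ T → ∀ (f : M ↪[L] N) (k m : ℕ)
      (φ : L.BoundedFormula (Fin k) m), φ.IsQF → ∀ b : Fin k → M,
        (∃ a : Fin m → N, φ.Realize (f ∘ b) a) → ∃ a : Fin m → M, φ.Realize b a

/-- The common first-order theory of all existentially closed models of `T`. -/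
def ecTheory (T : L.Theory) : L.Theory :=
  {σ | ∀ (M : Type) [L.Structure M], IsECModel T M → M ⊨ σ}

/-- `T` is model complete: every embedding between models of `T` is elementary. -/
def IsModelComplete (T : L.Theory) : Prop :=
  ∀ (M N : Type) [L.Structure M] [L.Structure N], M ⊨ T → N ⊨ T →
    ∀ (f : M ↪[L] N) (n : ℕ) (φ : L.Formula (Fin n)) (x : Fin n → M),
      φ.Realize (f ∘ x) ↔ φ.Realize x

/-- `T'` is a model companion of `T`: it is model complete, every model of `T` embeds in
a model of `T'`, and every model of `T'` embeds in a model of `T`. -/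
structure IsModelCompanion (T T' : L.Theory) : Prop where
  modelComplete : IsModelComplete T'
  embeds : ∀ (M : Type) [L.Structure M], M ⊨ T →
    ∃ (N : Type) (_ : L.Structure N), N ⊨ T' ∧ Nonempty (M ↪[L] N)
  embeds' : ∀ (M : Type) [L.Structure M], M ⊨ T' →
    ∃ (N : Type) (_ : L.Structure N), N ⊨ T ∧ Nonempty (M ↪[L] N)

end ModelTheory

/-! ### The language of rings with a unary predicate `G`, and the theories -/

/-- The relation symbols of the language with a single unary predicate. -/
inductive PredRel : ℕ → Type
  | G : PredRel 1

/-- The language with a single unary predicate `G`. -/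
def predLang : FirstOrder.Language.{0, 0} := ⟨fun _ => Empty, PredRel⟩

/-- The language of rings together with a unary predicate `G`. -/
abbrev ringG : FirstOrder.Language.{0, 0} := Language.ring.sum predLang

/-- The predicate symbol `G` in the language of rings with a predicate. -/
abbrev symG : ringG.Relations 1 := Sum.inr PredRel.G

/-- `G(0)`. -/
def axiomZero : ringG.Sentence :=
  symG.boundedFormula₁ ((LHom.sumInl : Language.ring →ᴸ ringG).onTerm 0)

/-- `∀ x y, G(x) → G(y) → G(x + y)`. -/
def axiomAdd : ringG.Sentence :=
  ∀' ∀' (symG.boundedFormula₁ (&0) ⟹ (symG.boundedFormula₁ (&1) ⟹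
    symG.boundedFormula₁ ((LHom.sumInl : Language.ring →ᴸ ringG).onTerm (&0 + &1))))

/-- `∀ x, G(x) → G(-x)`. -/
def axiomNeg : ringG.Sentence :=
  ∀' (symG.boundedFormula₁ (&0) ⟹
    symG.boundedFormula₁ ((LHom.sumInl : Language.ring →ᴸ ringG).onTerm (-(&0))))

/-- The theory `ACF_G` of algebraically closed fields of characteristic `p` in which `G` is an
additive subgroup. -/
noncomputable def ACFsubG (p : ℕ) : ringG.Theory :=
  (LHom.sumInl : Language.ring →ᴸ ringG).onTheory (Theory.ACF p) ∪ {axiomZero, axiomAdd, axiomNeg}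

/-- The theory `ACFG`: the theory of the existentially closed models of `ACF_G`. As `ACF_G` is
inductive, this is its model companion: a model companion is unique up to equivalence and
axiomatises the class of existentially closed models. -/
noncomputable def theoryACFG (p : ℕ) : ringG.Theory := ecTheory (ACFsubG p)

/-- The structure `(K, G)`: the ring `K` with the predicate interpreted by the subgroup `G`. -/
abbrev pairStructure {K : Type} [Ring K] (G : AddSubgroup K) : ringG.Structure K :=
  letI : Language.ring.Structure K := (FirstOrder.Ring.compatibleRingOfRing K).toStructure
  letI : predLang.Structure K :=
    { funMap := fun f => f.elim
      RelMap := fun {_} r => match r with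
        | PredRel.G => fun x => x 0 ∈ G }
  inferInstance

/-- `(K, G) ⊨ T`. -/
def PairModels {K : Type} [Ring K] (G : AddSubgroup K) (T : ringG.Theory) : Prop :=
  letI := pairStructure G
  K ⊨ T

/-! ### Subgroups of the algebraic closure of the prime field -/

/-- The Chabauty topology on the set of subgroups of a discrete group `A`: the coarsest topology for
which all the sets `{H | x ∈ H}` are clopen, i.e. the one induced by the product topology
on the set of subsets of `A`. -/
instance chabautyTopology (A : Type) [AddGroup A] : TopologicalSpace (AddSubgroup A) :=
  TopologicalSpace.generateFrom
    {U | ∃ x : A, U = {H : AddSubgroup A | x ∈ H} ∨ U = {H : AddSubgroup A | x ∉ H}}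

section Fpbar

variable (p : ℕ) [Fact p.Prime]

/-- The algebraic closure of the field with `p` elements. -/
abbrev Fpbar : Type := AlgebraicClosure (ZMod p)

/-- The subfield with `p ^ n` elements (`n ≥ 1`): the solutions of `x ^ (p ^ n) = x`. -/
noncomputable def finiteSubfield (n : ℕ) : Subfield (Fpbar p) :=
  (iterateFrobenius (Fpbar p) p n).eqLocusField (RingHom.id (Fpbar p))

/-- The set of subgroups `G` with `(Fpbar, G) ⊨ ACFG`. -/
def genericSubgroups : Set (AddSubgroup (Fpbar p)) :=
  {G | PairModels G (theoryACFG p)}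

/-- The ball of the subgroups `H` with `H ∩ 𝔽_{p^n} = H₀`. -/
def ball (H₀ : AddSubgroup (Fpbar p)) (n : ℕ) : Set (AddSubgroup (Fpbar p)) :=
  {H | H ⊓ (finiteSubfield p n).toAddSubgroup = H₀}

theorem mem_finiteSubfield {n : ℕ} {x : Fpbar p} :
    x ∈ finiteSubfield p n ↔ x ^ p ^ n = x := by
  simp [finiteSubfield, iterateFrobenius_def]

theorem finite_finiteSubfield {n : ℕ} (hn : 1 ≤ n) :
    (finiteSubfield p n : Set (Fpbar p)).Finite := by
  classical
  have h1 : 1 < p ^ n := Nat.one_lt_pow (by omega) (Fact.out : p.Prime).one_lt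
  refine Set.Finite.subset
    ((Polynomial.X ^ p ^ n - Polynomial.X : Polynomial (Fpbar p)).roots.toFinset.finite_toSet) ?_
  intro x hx
  have hx' : x ^ p ^ n = x := (mem_finiteSubfield p).1 hx
  have := FiniteField.X_pow_card_sub_X_ne_zero (Fpbar p) h1
  simp [this, Polynomial.IsRoot, hx']

theorem exists_mem_finiteSubfield (x : Fpbar p) : ∃ n, 1 ≤ n ∧ x ∈ finiteSubfield p n := by
  have hx : IsIntegral (ZMod p) x := Algebra.IsIntegral.isIntegral x
  let F := IntermediateField.adjoin (ZMod p) {x}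
  have : FiniteDimensional (ZMod p) F := IntermediateField.adjoin.finiteDimensional hx
  have : Finite F := Module.finite_of_finite (ZMod p)
  have : Fintype F := Fintype.ofFinite F
  refine ⟨Module.finrank (ZMod p) F, Module.finrank_pos, (mem_finiteSubfield p).2 ?_⟩
  have hc : Fintype.card F = p ^ Module.finrank (ZMod p) F := by
    rw [Module.card_eq_pow_finrank (K := ZMod p), ZMod.card]
  have := FiniteField.pow_card (⟨x, IntermediateField.mem_adjoin_simple_self _ x⟩ : F)
  rw [hc] at this
  simpa using congrArg (Subtype.val) this

/-- The Chabauty topology on the subgroups of `Fpbar` is generated by the balls. -/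
theorem chabautyTopology_eq_generateFrom_ball :
    chabautyTopology (Fpbar p) =
      TopologicalSpace.generateFrom {U | ∃ (H₀ : AddSubgroup (Fpbar p)) (n : ℕ), 1 ≤ n ∧
        U = ball p H₀ n} := by
  classical
  apply le_antisymm
  · rw [TopologicalSpace.le_generateFrom_iff_subset_isOpen]
    rintro _ ⟨H₀, n, hn, rfl⟩
    by_cases hH : H₀ ≤ (finiteSubfield p n).toAddSubgroup
    · have : ball p H₀ n = ⋂ x ∈ (finiteSubfield p n : Set (Fpbar p)),
          {H : AddSubgroup (Fpbar p) | x ∈ H ↔ x ∈ H₀} := by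
        ext H
        simp only [ball, Set.mem_ofPred_eq, Set.mem_iInter, SetLike.mem_coe]
        constructor
        · rintro rfl x hx
          exact ⟨fun h => ⟨h, hx⟩, fun h => h.1⟩
        · intro h
          ext x
          exact ⟨fun hx => (h x hx.2).1 hx.1, fun hx => ⟨(h x (hH hx)).2 hx, hH hx⟩⟩
      rw [Set.mem_ofPred_eq, this]
      refine (finite_finiteSubfield p hn).isOpen_biInter fun x _ => ?_
      by_cases hx : x ∈ H₀
      · simp only [hx, iff_true]
        exact TopologicalSpace.isOpen_generateFrom_of_mem ⟨x, Or.inl rfl⟩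
      · simp only [hx, iff_false]
        exact TopologicalSpace.isOpen_generateFrom_of_mem ⟨x, Or.inr rfl⟩
    · have : ball p H₀ n = ∅ := by
        ext H
        simp only [ball, Set.mem_ofPred_eq, Set.mem_empty_iff_false, iff_false]
        rintro rfl
        exact hH inf_le_right
      rw [Set.mem_ofPred_eq, this]
      exact @isOpen_empty _ (chabautyTopology (Fpbar p))
  · refine le_generateFrom ?_
    have key : ∀ (x : Fpbar p) (P : Prop), @IsOpen _ (TopologicalSpace.generateFrom
        {U | ∃ (H₀ : AddSubgroup (Fpbar p)) (n : ℕ), 1 ≤ n ∧ U = ball p H₀ n})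
        {H : AddSubgroup (Fpbar p) | x ∈ H ↔ P} := by
      intro x P
      obtain ⟨n, hn, hx⟩ := exists_mem_finiteSubfield p x
      have : {H : AddSubgroup (Fpbar p) | x ∈ H ↔ P} =
          ⋃ H₀ ∈ {H₀ : AddSubgroup (Fpbar p) | x ∈ H₀ ↔ P}, ball p H₀ n := by
        ext H
        simp only [ball, Set.mem_ofPred_eq, Set.mem_iUnion, exists_prop, exists_eq_right']
        exact ⟨fun h => ⟨fun h' => h.1 h'.1, fun h' => ⟨h.2 h', hx⟩⟩,
          fun h => ⟨fun h' => h.1 ⟨h', hx⟩, fun h' => (h.2 h').1⟩⟩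
      rw [this]
      let := TopologicalSpace.generateFrom
        {U | ∃ (H₀ : AddSubgroup (Fpbar p)) (n : ℕ), 1 ≤ n ∧ U = ball p H₀ n}
      exact isOpen_biUnion fun H₀ _ =>
        TopologicalSpace.isOpen_generateFrom_of_mem ⟨H₀, n, hn, rfl⟩
    rintro _ ⟨x, rfl | rfl⟩
    · simpa using key x True
    · simpa using key x False

end Fpbar

end ACFG

/-! A quantifier-free formula at a tuple only asks which of finitely many elements vanish and which
lie in the subgroup, and in characteristic p these elements generate a finite group V. Hence a
solution of φ(b, x) in an extension N of the pair on `Fpbar` involves only a finite piece of its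
subgroup.

Two transfer results follow. By free amalgamation over `Fpbar`, solvability in an extension depends
only on the trace of G on some finite subfield (`exists_finiteSubfield_solvable`). By
specialisation, a finitely generated `Fpbar`-subalgebra of N has an `Fpbar`-point that is injective
on V, which carries the solution to `Fpbar` for a subgroup H with a prescribed finite trace
(`exists_mem_ball_sat`).

The first result makes the relevant instances of existential closedness first-order, so that on
`Fpbar` being a model of ACFG equals being existentially closed (`mem_genericSubgroups_iff`). For
each φ and b the condition "solvable in an extension implies solvable" is then Gδ by openness and
dense by specialisation. There are countably many conditions and the Chabauty space is compact
Hausdorff, so Baire gives part 1; part 2 is density applied to a ball.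

For part 3, the ∀∃ axioms of `ACFsubG` descend to models of a companion T, which are then
existentially closed by model completeness. Conversely, an existentially closed model is elementary
in a model of T, by compactness and the Tarski–Vaught test. -/

namespace ACFG

/-! ### Points of finitely generated algebras and tensor products of fields -/

section CommutativeAlgebra

open TensorProduct

/-- A finitely generated domain over an algebraically closed field has a point at which a given
nonzero element does not vanish. -/
theorem exists_algHom_apply_ne_zero {k A : Type*} [Field k] [IsAlgClosed k] [CommRing A]
    [IsDomain A] [Algebra k A] [Algebra.FiniteType k A] {f : A} (hf : f ≠ 0) :
    ∃ s : A →ₐ[k] k, s f ≠ 0 := by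
  have : IsJacobsonRing A := isJacobsonRing_of_finiteType (A := k)
  -- The zero ideal is an intersection of maximal ideals, so one of them misses f; its residue field
  -- is k by the Nullstellensatz.
  have hj : (⊥ : Ideal A).jacobson = ⊥ :=
    IsJacobsonRing.out ‹_› Ideal.isPrime_bot.isRadical
  have hf' : f ∉ (⊥ : Ideal A).jacobson := by rw [hj]; simpa using hf
  rw [Ideal.jacobson, Ideal.mem_sInf] at hf'
  push Not at hf'
  obtain ⟨m, ⟨-, hm⟩, hfm⟩ := hf'
  let : Field (A ⧸ m) := Ideal.Quotient.field m
  have : Module.Finite k (A ⧸ m) := finite_of_finite_type_of_isJacobsonRing k (A ⧸ m)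
  let e : k ≃ₐ[k] (A ⧸ m) := AlgEquiv.ofBijective (Algebra.ofId k (A ⧸ m))
    (IsAlgClosed.algebraMap_bijective_of_isIntegral (k := k))
  refine ⟨(e.symm : (A ⧸ m) →ₐ[k] k).comp (Ideal.Quotient.mkₐ k m), ?_⟩
  simpa [Ideal.Quotient.eq_zero_iff_mem] using hfm

/-- A finitely generated domain over an algebraically closed field has a point at which no element
of a given finite set of nonzero elements vanishes. -/
theorem exists_algHom_forall_ne_zero {k A : Type*} [Field k] [IsAlgClosed k] [CommRing A]
    [IsDomain A] [Algebra k A] [Algebra.FiniteType k A] {V : Set A} (hV : V.Finite) :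
    ∃ s : A →ₐ[k] k, ∀ v ∈ V, v ≠ 0 → s v ≠ 0 := by
  classical
  obtain ⟨s, hs⟩ := exists_algHom_apply_ne_zero (k := k)
    (f := ∏ v ∈ hV.toFinset.filter (· ≠ 0), v)
    (Finset.prod_ne_zero_iff.2 fun v hv => (Finset.mem_filter.1 hv).2)
  rw [map_prod, Finset.prod_ne_zero_iff] at hs
  exact ⟨s, fun v hv hv0 => hs v (by simp [hv, hv0])⟩

/-- The tensor product of two field extensions of an algebraically closed field is a domain. -/
theorem isDomain_tensorProduct (k N M : Type*) [Field k] [IsAlgClosed k] [Field N] [Field M]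
    [Algebra k N] [Algebra k M] : IsDomain (N ⊗[k] M) := by
  classical
  have : NoZeroDivisors (N ⊗[k] M) := ⟨by
    intro x y hxy
    by_contra! hne
    let b := Module.Free.chooseBasis k M
    let bN := Algebra.TensorProduct.basis N b
    obtain ⟨i, hi⟩ : ∃ i, bN.repr x i ≠ 0 := by
      by_contra! h
      exact hne.1 (bN.ext_elem fun i => by simpa using h i)
    obtain ⟨j, hj⟩ : ∃ j, bN.repr y j ≠ 0 := by
      by_contra! h
      exact hne.2 (bN.ext_elem fun i => by simpa using h i)
    -- Only finitely many coefficients occur. A k-point s of the algebra they generate, nonzero at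
    -- the i-th coefficient of x and the j-th of y, turns xy = 0 into a zero product of nonzero
    -- elements of M.
    let S : Finset N := (bN.repr x).support.image (bN.repr x) ∪
      (bN.repr y).support.image (bN.repr y)
    let A := Algebra.adjoin k (S : Set N)
    have : Algebra.FiniteType k A := (Subalgebra.fg_iff_finiteType _).1 ⟨S, rfl⟩
    have hx (l) : bN.repr x l ∈ A := by
      by_cases h : bN.repr x l = 0
      · simp [h]
      · exact Algebra.subset_adjoin (Finset.mem_coe.2 (Finset.mem_union_left _
          (Finset.mem_image_of_mem _ (by simpa using h))))
    have hy (l) : bN.repr y l ∈ A := by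
      by_cases h : bN.repr y l = 0
      · simp [h]
      · exact Algebra.subset_adjoin (Finset.mem_coe.2 (Finset.mem_union_right _
          (Finset.mem_image_of_mem _ (by simpa using h))))
    obtain ⟨s, hs⟩ := exists_algHom_apply_ne_zero (k := k) (A := A)
      (f := ⟨_, hx i⟩ * ⟨_, hy j⟩) (by simpa [Subtype.ext_iff] using ⟨hi, hj⟩)
    let bA := Algebra.TensorProduct.basis A b
    let F : A ⊗[k] M →ₐ[k] N ⊗[k] M := Algebra.TensorProduct.map A.val (AlgHom.id k M)
    have hF : Function.Injective F :=
      Module.Flat.rTensor_preserves_injective_linearMap (M := M) A.val.toLinearMap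
        Subtype.val_injective
    let σ : A ⊗[k] M →ₐ[k] M := Algebra.TensorProduct.lift ((Algebra.ofId k M).comp s)
      (AlgHom.id k M) fun _ _ => Commute.all _ _
    have key : ∀ z : N ⊗[k] M, (hz : ∀ l, bN.repr z l ∈ A) → ∃ z' : A ⊗[k] M, F z' = z ∧
        ∀ l, b.repr (σ z') l = s ⟨_, hz l⟩ := by
      intro z hz
      refine ⟨∑ l ∈ (bN.repr z).support, (⟨_, hz l⟩ : A) ⊗ₜ b l, ?_, ?_⟩
      · conv_rhs => rw [← bN.linearCombination_repr z, Finsupp.linearCombination_apply]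
        simp [F, bN, Finsupp.sum, TensorProduct.smul_tmul']
      · intro l
        have hσ (a : A) (m : M) : σ (a ⊗ₜ m) = s a • m := by
          simp [σ, Algebra.ofId_apply, Algebra.smul_def]
        simp only [map_sum, hσ, map_smul, Module.Basis.repr_self, Finsupp.finsetSum_apply,
          Finsupp.smul_apply, Finsupp.single_apply, smul_eq_mul, mul_ite, mul_one, mul_zero,
          Finset.sum_ite_eq']
        split_ifs with hl
        · rfl
        · have h0 : (⟨_, hz l⟩ : A) = 0 := Subtype.ext (by simpa using hl)
          rw [h0, map_zero]
    obtain ⟨x', hx', hxs⟩ := key x hx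
    obtain ⟨y', hy', hys⟩ := key y hy
    have h0 : x' * y' = 0 := hF (by rw [map_mul, hx', hy', hxy, map_zero])
    have h1 : σ x' * σ y' = 0 := by rw [← map_mul, h0, map_zero]
    rw [map_mul] at hs
    rcases mul_eq_zero.1 h1 with h | h
    · apply left_ne_zero_of_mul hs
      rw [← hxs, h]; simp
    · apply right_ne_zero_of_mul hs
      rw [← hys, h]; simp⟩
  have : Nontrivial (N ⊗[k] M) := inferInstance
  exact NoZeroDivisors.to_isDomain _

/-- The two factors of a tensor product of field extensions meet in the base field. -/
theorem exists_algebraMap_eq_of_tmul_one_eq_one_tmul {k N M : Type*} [Field k] [Field N] [Field M]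
    [Algebra k N] [Algebra k M] {v : N} {m : M} (h : v ⊗ₜ[k] (1 : M) = (1 : N) ⊗ₜ[k] m) :
    ∃ x : k, v = algebraMap k N x ∧ m = algebraMap k M x := by
  have hv : v ∈ Submodule.span k {(1 : N)} := by
    by_contra hv
    -- A functional that kills 1 but not v, applied to the left factors, kills only one side of the
    -- equation.
    obtain ⟨l, hl, hle⟩ := Submodule.exists_le_ker_of_notMem hv
    have h1 : l 1 = 0 := hle (Submodule.mem_span_singleton_self 1)
    have := congrArg (TensorProduct.lid k M ∘ l.rTensor M) h
    simp [h1] at this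
    exact hl this
  obtain ⟨x, rfl⟩ := Submodule.mem_span_singleton.1 hv
  refine ⟨x, (Algebra.algebraMap_eq_smul_one x).symm, ?_⟩
  have h2 : (1 : N) ⊗ₜ[k] (algebraMap k M x) = (1 : N) ⊗ₜ[k] m := by
    rw [← h, Algebra.algebraMap_eq_smul_one, TensorProduct.tmul_smul, TensorProduct.smul_tmul']
  exact (Algebra.TensorProduct.includeRight_injective (R := k) (A := N) (B := M)
    (algebraMap k N).injective h2).symm

end CommutativeAlgebra

/-! ### Models of `ACFsubG` as pairs of a field and a subgroup -/

section Pairs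

open FirstOrder.Ring

/-- Satisfaction of a formula in the structure `(K, G)`. -/
def Sat {K : Type} [Ring K] (G : AddSubgroup K) {α : Type} {m : ℕ} (φ : ringG.BoundedFormula α m)
    (v : α → K) (xs : Fin m → K) : Prop :=
  letI := pairStructure G
  φ.Realize v xs

/-- Evaluation of terms commutes with ring homomorphisms. -/
theorem exists_term_realize_eq {A α : Type} [CommRing A] (t : ringG.Term α) (β : α → A) :
    ∃ a : A, ∀ (K : Type) [Ring K] (G : AddSubgroup K) (i : A →+* K),
      (letI := pairStructure G; t.realize (i ∘ β)) = i a := by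
  induction t with
  | var x => exact ⟨β x, fun _ _ _ _ => rfl⟩
  | func f ts ih =>
    choose a ha using ih
    rcases f with f | f
    · cases f with
      | add =>
        refine ⟨a 0 + a 1, fun K _ G i => ?_⟩
        rw [map_add, ← ha 0 K G i, ← ha 1 K G i]; rfl
      | mul =>
        refine ⟨a 0 * a 1, fun K _ G i => ?_⟩
        rw [map_mul, ← ha 0 K G i, ← ha 1 K G i]; rfl
      | neg =>
        refine ⟨- a 0, fun K _ G i => ?_⟩
        rw [map_neg, ← ha 0 K G i]; rfl
      | zero => exact ⟨0, fun K _ G i => by rw [map_zero]; rfl⟩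
      | one => exact ⟨1, fun K _ G i => by rw [map_one]; rfl⟩
    · exact f.elim

/-- The truth of a quantifier-free formula at a tuple from `A` under a homomorphism from `A` to a
pair depends only on which members of a finite subset of `A` are sent to zero and to the
subgroup. -/
theorem exists_finset_sat_iff {A α : Type} [CommRing A] {m : ℕ} {φ : ringG.BoundedFormula α m}
    (hφ : φ.IsQF) (β : α → A) (γ : Fin m → A) :
    ∃ S : Finset A, ∀ (K K' : Type) [Ring K] [Ring K'] (G : AddSubgroup K) (G' : AddSubgroup K')
      (i : A →+* K) (j : A →+* K'), (∀ s ∈ S, (i s = 0 ↔ j s = 0) ∧ (i s ∈ G ↔ j s ∈ G')) →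
        (Sat G φ (i ∘ β) (i ∘ γ) ↔ Sat G' φ (j ∘ β) (j ∘ γ)) := by
  classical
  induction hφ with
  | falsum => exact ⟨∅, fun _ _ _ _ _ _ _ _ _ => Iff.rfl⟩
  | of_isAtomic h =>
    cases h with
    | equal t₁ t₂ =>
      obtain ⟨a₁, h₁⟩ := exists_term_realize_eq t₁ (Sum.elim β γ)
      obtain ⟨a₂, h₂⟩ := exists_term_realize_eq t₂ (Sum.elim β γ)
      refine ⟨{a₁ - a₂}, fun K K' _ _ G G' i j h => ?_⟩
      have := (h _ (Finset.mem_singleton_self _)).1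
      rw [map_sub, map_sub, sub_eq_zero, sub_eq_zero, ← h₁ K G, ← h₂ K G, ← h₁ K' G', ← h₂ K' G',
        Sum.comp_elim, Sum.comp_elim] at this
      exact this
    | rel R ts =>
      rcases R with R | R
      · exact R.elim
      · cases R with
        | G =>
          obtain ⟨a, ha⟩ := exists_term_realize_eq (ts 0) (Sum.elim β γ)
          refine ⟨{a}, fun K K' _ _ G G' i j h => ?_⟩
          have := (h _ (Finset.mem_singleton_self _)).2
          rw [← ha K G, ← ha K' G', Sum.comp_elim, Sum.comp_elim] at this
          exact this
  | imp _ _ ih₁ ih₂ =>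
    obtain ⟨S₁, h₁⟩ := ih₁
    obtain ⟨S₂, h₂⟩ := ih₂
    refine ⟨S₁ ∪ S₂, fun K K' _ _ G G' i j h => ?_⟩
    exact imp_congr (h₁ K K' G G' i j fun s hs => h s (Finset.mem_union_left _ hs))
      (h₂ K K' G G' i j fun s hs => h s (Finset.mem_union_right _ hs))

/-- Pairs of an algebraically closed field of characteristic `p` and a subgroup are models
of `ACF_G`. -/
theorem pairModels_ACFsubG {K : Type} [Field K] [IsAlgClosed K] (p : ℕ) [CharP K p]
    (G : AddSubgroup K) : PairModels G (ACFsubG p) := by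
  let : CompatibleRing K := compatibleRingOfRing K
  let := pairStructure G
  have h1 : K ⊨ (LHom.sumInl : Language.ring →ᴸ ringG).onTheory (Theory.ACF p) := by
    rw [LHom.onTheory_model]
    infer_instance
  refine Theory.model_union_iff.2 ⟨h1, ?_⟩
  simp only [Theory.model_iff, Set.mem_insert_iff, Set.mem_singleton_iff, forall_eq_or_imp,
    forall_eq]
  refine ⟨?_, ?_, ?_⟩
  · exact G.zero_mem
  · exact fun x y (hx : x ∈ G) (hy : y ∈ G) => G.add_mem hx hy
  · exact fun x (hx : x ∈ G) => G.neg_mem hx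

/-- Every model of `ACF_G` is the pair of an algebraically closed field of characteristic `p` and
a subgroup. -/
theorem exists_eq_pairStructure {p : ℕ} {N : Type} [inst : ringG.Structure N]
    (h : N ⊨ ACFsubG p) :
    ∃ (_ : Field N) (_ : IsAlgClosed N) (_ : CharP N p) (G : AddSubgroup N),
      inst = pairStructure G := by
  rw [ACFsubG, Theory.model_union_iff] at h
  obtain ⟨h1, h2⟩ := h
  let : Language.ring.Structure N := (LHom.sumInl : Language.ring →ᴸ ringG).reduct N
  rw [LHom.onTheory_model] at h1
  have := Field.modelField_of_modelACF p N
  let := Field.fieldOfModelField N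
  let := Field.compatibleRingOfModelField N
  have hAC := Field.isAlgClosed_of_model_ACF p N
  have hp := Field.charP_of_model_fieldOfChar p N
  simp only [Theory.model_iff, Set.mem_insert_iff, Set.mem_singleton_iff, forall_eq_or_imp,
    forall_eq] at h2
  obtain ⟨h0, ha, hn⟩ := h2
  simp only [axiomZero, axiomAdd, axiomNeg, Sentence.Realize, Formula.Realize,
    BoundedFormula.realize_rel₁, BoundedFormula.realize_all, BoundedFormula.realize_imp,
    LHom.realize_onTerm, realize_zero, realize_add, realize_neg, Term.realize_var,
    Function.comp_apply, Sum.elim_inr] at h0 ha hn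
  have hvec (v : Fin 1 → N) : v = ![v 0] := List.ofFn_inj.mp rfl
  let G : AddSubgroup N :=
    { carrier := {x | Structure.RelMap symG ![x]}
      zero_mem' := h0
      add_mem' := fun {x y} hx hy => ha x y hx hy
      neg_mem' := fun {x} hx => hn x hx }
  refine ⟨inferInstance, hAC, hp, G, ?_⟩
  ext n f x
  · rcases f with f | f
    · cases f with
      | add => exact CompatibleRing.funMap_add x
      | mul => exact CompatibleRing.funMap_mul x
      | neg => exact CompatibleRing.funMap_neg x
      | zero => exact CompatibleRing.funMap_zero x
      | one => exact CompatibleRing.funMap_one x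
    · exact f.elim
  · rcases f with f | f
    · exact f.elim
    · cases f with
      | G =>
        rw [hvec x]
        rfl

/-- A homomorphism of fields that respects the subgroups is an embedding of pairs. -/
theorem exists_embedding_of_ringHom {K K' : Type} [Field K] [Field K'] {G : AddSubgroup K}
    {G' : AddSubgroup K'} (i : K →+* K') (h : ∀ x, i x ∈ G' ↔ x ∈ G) :
    letI := pairStructure G
    letI := pairStructure G'
    ∃ f : K ↪[ringG] K', ∀ x, f x = i x := by
  let := pairStructure G
  let := pairStructure G'
  refine ⟨⟨⟨i, i.injective⟩, ?_, ?_⟩, fun x => rfl⟩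
  · intro n f x
    rcases f with f | f
    · cases f with
      | add => exact map_add i _ _
      | mul => exact map_mul i _ _
      | neg => exact map_neg i _
      | zero => exact map_zero i
      | one => exact map_one i
    · exact f.elim
  · intro n f x
    rcases f with f | f
    · exact f.elim
    · cases f with
      | G => exact h _

/-- An embedding of pairs is a homomorphism of fields that respects the subgroups. -/
theorem exists_ringHom_of_embedding {K K' : Type} [Field K] [Field K'] {G : AddSubgroup K}
    {G' : AddSubgroup K'} :
    letI := pairStructure G
    letI := pairStructure G'
    ∀ f : K ↪[ringG] K', ∃ i : K →+* K', (∀ x, f x = i x) ∧ ∀ x, i x ∈ G' ↔ x ∈ G := by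
  let := pairStructure G
  let := pairStructure G'
  intro f
  refine ⟨{ toFun := f, map_zero' := ?_, map_one' := ?_, map_add' := ?_, map_mul' := ?_ },
    fun x => rfl, fun x => ?_⟩
  · exact f.map_fun (Sum.inl .one : ringG.Functions 0) ![]
  · exact fun x y => f.map_fun (Sum.inl .mul : ringG.Functions 2) ![x, y]
  · exact f.map_fun (Sum.inl .zero : ringG.Functions 0) ![]
  · exact fun x y => f.map_fun (Sum.inl .add : ringG.Functions 2) ![x, y]
  · exact f.map_rel symG ![x]

end Pairs

/-! ### Amalgamation and specialisation of solutions -/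

section Extensions

/-- The formula `φ(b, x)` has a solution in some extension of the pair `(K, G)`. -/
def SolvableInExtension {K : Type} [Field K] (G : AddSubgroup K) {α : Type} {m : ℕ}
    (φ : ringG.BoundedFormula α m) (b : α → K) : Prop :=
  ∃ (N : Type) (_ : Field N) (_ : IsAlgClosed N) (H : AddSubgroup N) (i : K →+* N)
    (c : Fin m → N), (∀ x, i x ∈ H ↔ x ∈ G) ∧ Sat H φ (i ∘ b) c

/-- Models of `ACFsubG` are exactly pairs, and embeddings are field homomorphisms that preserve and
reflect the subgroup. The characteristic of the larger field comes from the embedding. -/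
theorem isECModel_pairStructure_iff {K : Type} [Field K] [IsAlgClosed K] (p : ℕ) [CharP K p]
    (G : AddSubgroup K) :
    (letI := pairStructure G; IsECModel (ACFsubG p) K) ↔
      ∀ (k m : ℕ) (φ : ringG.BoundedFormula (Fin k) m), φ.IsQF → ∀ b : Fin k → K,
        SolvableInExtension G φ b → ∃ a, Sat G φ b a := by
  let := pairStructure G
  constructor
  · rintro ⟨-, h⟩ k m φ hφ b ⟨N, _, _, H, i, c, hi, hc⟩
    have := charP_of_injective_ringHom i.injective p
    obtain ⟨f, hf⟩ := exists_embedding_of_ringHom i hi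
    let := pairStructure H
    refine h N (pairModels_ACFsubG p H) f k m φ hφ b ⟨c, ?_⟩
    rw [show f ∘ b = i ∘ b from funext fun _ => hf _]
    exact hc
  · refine fun h => ⟨pairModels_ACFsubG p G, ?_⟩
    rintro N inst hN f k m φ hφ b ⟨a, ha⟩
    obtain ⟨_, _, _, H, rfl⟩ := exists_eq_pairStructure hN
    obtain ⟨i, hi, hG⟩ := exists_ringHom_of_embedding f
    refine h k m φ hφ b ⟨N, _, ‹_›, H, i, a, hG, ?_⟩
    rw [← show f ∘ b = i ∘ b from funext fun _ => hi _]
    exact ha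

variable (p : ℕ) [Fact p.Prime]

/-- In characteristic `p` every finite set lies in a finite additive subgroup. -/
theorem exists_finite_addSubgroup {R : Type} [CommRing R] [CharP R p] {S : Set R}
    (hS : S.Finite) : ∃ V : AddSubgroup R, (V : Set R).Finite ∧ S ⊆ V := by
  let : Algebra (ZMod p) R := ZMod.algebra R p
  refine ⟨(Submodule.span (ZMod p) S).toAddSubgroup, ?_, Submodule.subset_span⟩
  have := FiniteDimensional.span_of_finite (ZMod p) hS
  have : Finite (Submodule.span (ZMod p) S) := Module.finite_of_finite (ZMod p)
  exact Set.toFinite _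

theorem finiteSubfield_le_of_dvd {m n : ℕ} (h : m ∣ n) : finiteSubfield p m ≤ finiteSubfield p n := by
  obtain ⟨d, rfl⟩ := h
  intro x hx
  rw [mem_finiteSubfield] at hx ⊢
  induction d with
  | zero => simp
  | succ d ih => rw [mul_add, mul_one, pow_add, pow_mul, ih, hx]

/-- Every finite subset of `Fpbar` lies in a finite subfield. -/
theorem exists_subset_finiteSubfield {S : Set (Fpbar p)} (hS : S.Finite) :
    ∃ n, 1 ≤ n ∧ S ⊆ finiteSubfield p n := by
  induction S, hS using Set.Finite.induction_on with
  | empty => exact ⟨1, le_rfl, Set.empty_subset _⟩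
  | insert _ _ ih =>
    rename_i x S _ _
    obtain ⟨n, hn, hS⟩ := ih
    obtain ⟨m, hm, hx⟩ := exists_mem_finiteSubfield p x
    exact ⟨m * n, Nat.mul_pos hm hn, Set.insert_subset
      (finiteSubfield_le_of_dvd p (dvd_mul_right m n) hx)
      (hS.trans (finiteSubfield_le_of_dvd p (dvd_mul_left n m)))⟩

/-- An embedding of a finite subfield of `Fpbar` in an algebraically closed field extends to
`Fpbar`. -/
theorem exists_ringHom_extending {n : ℕ} {M : Type} [Field M] [IsAlgClosed M]
    (ι : finiteSubfield p n →+* M) : ∃ h : Fpbar p →+* M, ∀ x : finiteSubfield p n, h x = ι x := by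
  let := ι.toAlgebra
  have : Algebra.IsAlgebraic (finiteSubfield p n) (Fpbar p) := ⟨fun x => by
    obtain ⟨m, hm, hx⟩ := exists_mem_finiteSubfield p x
    have h1 : 1 < p ^ m := Nat.one_lt_pow (by omega) (Fact.out : p.Prime).one_lt
    refine ⟨_, FiniteField.X_pow_card_sub_X_ne_zero _ h1, ?_⟩
    simpa [sub_eq_zero] using (mem_finiteSubfield p).1 hx⟩
  let f : Fpbar p →ₐ[finiteSubfield p n] M := IsAlgClosed.lift
  exact ⟨f, fun x => f.commutes x⟩

open TensorProduct in
/-- Free amalgamation of two extensions of an algebraically closed field. -/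
theorem exists_amalgam {k N M : Type} [Field k] [IsAlgClosed k] [Field N] [Field M]
    (i : k →+* N) (h : k →+* M) :
    ∃ (Ω : Type) (_ : Field Ω) (_ : IsAlgClosed Ω) (jN : N →+* Ω) (jM : M →+* Ω),
      (∀ x, jN (i x) = jM (h x)) ∧ ∀ v m, jN v = jM m → ∃ x, v = i x ∧ m = h x := by
  let := i.toAlgebra
  let := h.toAlgebra
  have := isDomain_tensorProduct k N M
  let T := N ⊗[k] M
  let e : T →+* AlgebraicClosure (FractionRing T) :=
    (algebraMap (FractionRing T) (AlgebraicClosure (FractionRing T))).comp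
      (algebraMap T (FractionRing T))
  have he : Function.Injective e :=
    (algebraMap (FractionRing T) _).injective.comp (IsFractionRing.injective T (FractionRing T))
  refine ⟨AlgebraicClosure (FractionRing T), inferInstance, inferInstance,
    e.comp Algebra.TensorProduct.includeLeftRingHom,
    e.comp (Algebra.TensorProduct.includeRight (R := k) (A := N) (B := M)).toRingHom, ?_, ?_⟩
  · exact fun x => congrArg e
      ((Algebra.TensorProduct.includeLeft (R := k) (S := k) (A := N) (B := M)).commutes x |>.trans
        ((Algebra.TensorProduct.includeRight (R := k) (A := N) (B := M)).commutes x).symm)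
  · exact fun v m hvm => exists_algebraMap_eq_of_tmul_one_eq_one_tmul (he hvm)

/-- Solvability in an extension of `(Fpbar, G)` is witnessed by the trace of `G` on a finite
subfield, uniformly in all pairs that contain this trace. -/
theorem exists_finiteSubfield_solvable {G : AddSubgroup (Fpbar p)} {α : Type} [Finite α] {m : ℕ}
    {φ : ringG.BoundedFormula α m} (hφ : φ.IsQF) {b : α → Fpbar p}
    (h : SolvableInExtension G φ b) :
    ∃ n, 1 ≤ n ∧ ∃ b' : α → finiteSubfield p n, b = (↑) ∘ b' ∧
      ∀ (M : Type) [Field M] [IsAlgClosed M] (H : AddSubgroup M) (ι : finiteSubfield p n →+* M),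
        (∀ x, ι x ∈ H ↔ (x : Fpbar p) ∈ G) → SolvableInExtension H φ (ι ∘ b') := by
  obtain ⟨N, _, _, GN, i, c, hi, hc⟩ := h
  have := charP_of_injective_ringHom i.injective p
  obtain ⟨S, hS⟩ := exists_finset_sat_iff hφ (i ∘ b) c
  obtain ⟨V, hVfin, hSV⟩ := exists_finite_addSubgroup p S.finite_toSet
  -- The subfield must contain the parameters and every element of `Fpbar` whose image lies in V.
  obtain ⟨n, hn, hsub⟩ := exists_subset_finiteSubfield p
    ((hVfin.preimage i.injective.injOn).union (Set.finite_range b))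
  have hb (l) : b l ∈ finiteSubfield p n := hsub (Or.inr ⟨l, rfl⟩)
  refine ⟨n, hn, fun l => ⟨b l, hb l⟩, rfl, fun M _ _ H ι hι => ?_⟩
  -- Amalgamation needs an algebraically closed base, so ι is extended to all of `Fpbar`;
  -- compatibility with the subgroups is known only on the finite subfield.
  obtain ⟨h, hh⟩ := exists_ringHom_extending p ι
  obtain ⟨Ω, _, _, jN, jM, hcomm, hmeet⟩ := exists_amalgam i h
  have htrace (x : Fpbar p) (hx : i x ∈ V) : h x ∈ H ↔ i x ∈ GN := by
    have := hι ⟨x, hsub (Or.inl hx)⟩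
    rwa [← hh, ← hi] at this
  -- Only the finite part GN ⊓ V is adjoined, since the traces of GN and H on `Fpbar` may differ
  -- outside the finite subfield. An element of V that meets M comes from that subfield, where they
  -- agree.
  refine ⟨Ω, _, ‹_›, H.map jM.toAddMonoidHom ⊔ (GN ⊓ V).map jN.toAddMonoidHom, jM, jN ∘ c, ?_, ?_⟩
  · intro x
    refine ⟨fun hx => ?_, fun hx => AddSubgroup.mem_sup_left ⟨x, hx, rfl⟩⟩
    obtain ⟨_, ⟨g, hg, rfl⟩, _, ⟨v, ⟨hvG, hvV⟩, rfl⟩, hgv⟩ := AddSubgroup.mem_sup.1 hx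
    have hgv : jM g + jN v = jM x := hgv
    obtain ⟨y, rfl, hy⟩ := hmeet v (x - g) (by rw [map_sub, ← hgv]; ring)
    have := H.add_mem ((htrace y hvV).2 hvG) hg
    rwa [← hy, sub_add_cancel] at this
  · have hjb : jM ∘ ι ∘ (fun l => (⟨b l, hb l⟩ : finiteSubfield p n)) = jN ∘ i ∘ b := by
      funext l
      simp only [Function.comp_apply]
      rw [hcomm, ← hh]
    rw [hjb]
    refine (hS N Ω GN _ (RingHom.id N) jN fun s hs => ⟨?_, ?_⟩).1 hc
    · simp
    · refine ⟨fun hsG => AddSubgroup.mem_sup_right ⟨s, ⟨hsG, hSV hs⟩, rfl⟩, fun hsG => ?_⟩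
      obtain ⟨_, ⟨g, hg, rfl⟩, _, ⟨v, ⟨hvG, hvV⟩, rfl⟩, hgv⟩ := AddSubgroup.mem_sup.1 hsG
      have hgv : jM g + jN v = jN s := hgv
      obtain ⟨y, hy, rfl⟩ := hmeet (s - v) g (by rw [map_sub, ← hgv]; ring)
      have hyV : i y ∈ V := hy ▸ V.sub_mem (hSV hs) hvV
      have := GN.add_mem ((htrace y hyV).1 hg) hvG
      rwa [← hy, sub_add_cancel] at this

/-- If `φ(b, x)` has a solution in an extension of `(Fpbar, G)`, then it has one in `(Fpbar, H)` for
some `H` with the same trace as `G` on a given finite subfield that contains `b`. -/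
theorem exists_mem_ball_sat {G : AddSubgroup (Fpbar p)} {α : Type} {m : ℕ}
    {φ : ringG.BoundedFormula α m} (hφ : φ.IsQF) {b : α → Fpbar p}
    (h : SolvableInExtension G φ b) {n : ℕ} (hn : 1 ≤ n) :
    ∃ H ∈ ball p (G ⊓ (finiteSubfield p n).toAddSubgroup) n, ∃ a, Sat H φ b a := by
  obtain ⟨N, _, _, GN, i, c, hi, hc⟩ := h
  let := i.toAlgebra
  let A := Algebra.adjoin (Fpbar p) (Set.range c)
  have : Algebra.FiniteType (Fpbar p) A :=
    (Subalgebra.fg_iff_finiteType _).1 (Subalgebra.fg_def.2 ⟨_, Set.finite_range c, rfl⟩)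
  have : CharP A p := charP_of_injective_algebraMap (algebraMap (Fpbar p) A).injective p
  let γ : Fin m → A := fun l => ⟨c l, Algebra.subset_adjoin ⟨l, rfl⟩⟩
  obtain ⟨S, hS⟩ := exists_finset_sat_iff hφ (algebraMap (Fpbar p) A ∘ b) γ
  -- V contains the finite subfield besides the tested elements, so that H keeps the trace of G. As
  -- V is a group, a point that is nonzero on its nonzero elements is injective on it.
  obtain ⟨V, hVfin, hSV⟩ := exists_finite_addSubgroup p
    (S.finite_toSet.union ((finite_finiteSubfield p hn).image (algebraMap (Fpbar p) A)))
  obtain ⟨s, hs⟩ := exists_algHom_forall_ne_zero (k := Fpbar p) hVfin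
  have hinj {v w : A} (hv : v ∈ V) (hw : w ∈ V) (hvw : s v = s w) : v = w := by
    by_contra hne
    exact hs (v - w) (V.sub_mem hv hw) (sub_ne_zero.2 hne) (by rw [map_sub, hvw, sub_self])
  let H : AddSubgroup (Fpbar p) := (GN.comap A.val.toAddMonoidHom ⊓ V).map s.toAddMonoidHom
  have hH {v : A} (hv : v ∈ V) : s v ∈ H ↔ (v : N) ∈ GN := by
    refine ⟨?_, fun h => ⟨v, ⟨h, hv⟩, rfl⟩⟩
    rintro ⟨w, ⟨hwG, hwV⟩, hwv⟩
    rwa [← hinj hwV hv hwv]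
  refine ⟨H, ?_, s ∘ γ, ?_⟩
  · ext x
    refine and_congr_left fun hx => ?_
    have := hH (hSV (Or.inr ⟨x, hx, rfl⟩))
    rw [s.commutes] at this
    exact this.trans (hi x)
  · have h1 := (hS N (Fpbar p) GN H A.val s fun t ht => ?_).1 hc
    · have : b = (s : A →+* Fpbar p) ∘ algebraMap (Fpbar p) A ∘ b :=
        funext fun l => (s.commutes (b l)).symm
      rw [this]
      exact h1
    · have htV : t ∈ V := hSV (Or.inl ht)
      refine ⟨⟨fun h0 => ?_, fun h0 => ?_⟩, (hH htV).symm⟩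
      · have : t = 0 := Subtype.ext h0
        simp [this]
      · have : t = 0 := hinj htV V.zero_mem (by rw [map_zero]; exact h0)
        simp [this]

end Extensions

/-! ### Existential closedness over `Fpbar` is first-order -/

section Definability

open FirstOrder.Ring

/-- The diagram of a finite pair is expressed by a formula. -/
theorem exists_formula_diagram {F : Type} [Field F] [Finite F] (G₀ : AddSubgroup F) :
    ∃ θ : ringG.Formula F, ∀ (K : Type) [Field K] (G : AddSubgroup K) (y : F → K),
      Sat G θ y default ↔ ∃ ι : F →+* K, y = ι ∧ ∀ x, ι x ∈ G ↔ x ∈ G₀ := by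
  classical
  let tm (t : Language.ring.Term F) : ringG.Term F := (LHom.sumInl : Language.ring →ᴸ ringG).onTerm t
  -- Preservation of zero follows from additivity, and injectivity is automatic for fields.
  let θ : ringG.Formula F :=
    (tm (var 1)).equal (tm 1) ⊓
      (Formula.iInf fun a : F × F => (tm (var (a.1 + a.2))).equal (tm (var a.1 + var a.2))) ⊓
      (Formula.iInf fun a : F × F => (tm (var (a.1 * a.2))).equal (tm (var a.1 * var a.2))) ⊓
      (Formula.iInf fun a : F => if a ∈ G₀ then symG.formula₁ (var a) else ∼(symG.formula₁ (var a)))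
  refine ⟨θ, fun K _ G y => ?_⟩
  let : CompatibleRing K := compatibleRingOfRing K
  let := pairStructure G
  have hG (a : F) : (if a ∈ G₀ then (symG.formula₁ (var a)) else
      ∼(symG.formula₁ (var a)) : ringG.Formula F).Realize y ↔ (y a ∈ G ↔ a ∈ G₀) := by
    have h1 : (symG.formula₁ (var a) : ringG.Formula F).Realize y ↔ y a ∈ G :=
      Formula.realize_rel₁
    split_ifs with h
    · simp [h1, h]
    · rw [Formula.realize_not, h1]; simp [h]
  have h : Sat G θ y default ↔ ((y 1 = 1 ∧ ∀ a : F × F, y (a.1 + a.2) = y a.1 + y a.2) ∧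
      ∀ a : F × F, y (a.1 * a.2) = y a.1 * y a.2) ∧ ∀ a, y a ∈ G ↔ a ∈ G₀ := by
    change θ.Realize y ↔ _
    simp only [θ, tm, Formula.realize_inf, Formula.realize_iInf, Formula.realize_equal,
      LHom.realize_onTerm, hG, realize_add, realize_mul, realize_one, Term.realize_var]
  rw [h]
  constructor
  · rintro ⟨⟨⟨h1, ha⟩, hm⟩, hG⟩
    exact ⟨⟨⟨⟨y, h1⟩, fun a b => hm (a, b)⟩, by simpa using ha (0, 0), fun a b => ha (a, b)⟩, rfl, hG⟩
  · rintro ⟨ι, rfl, hι⟩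
    exact ⟨⟨⟨map_one ι, fun a => map_add ι _ _⟩, fun a => map_mul ι _ _⟩, hι⟩

variable (p : ℕ) [Fact p.Prime]

/-- `(Fpbar, G)` is a model of `ACFG` if and only if it is an existentially closed model
of `ACF_G`. -/
theorem mem_genericSubgroups_iff {G : AddSubgroup (Fpbar p)} :
    G ∈ genericSubgroups p ↔ ∀ (k m : ℕ) (φ : ringG.BoundedFormula (Fin k) m), φ.IsQF →
      ∀ b : Fin k → Fpbar p, SolvableInExtension G φ b → ∃ a, Sat G φ b a := by
  rw [← isECModel_pairStructure_iff p G]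
  constructor
  · intro hG
    rw [isECModel_pairStructure_iff p G]
    intro k m φ hφ b hb
    obtain ⟨n, hn, b, rfl, h⟩ := exists_finiteSubfield_solvable p hφ hb
    have : Finite (finiteSubfield p n) := finite_finiteSubfield p hn
    obtain ⟨θ, hθ⟩ := exists_formula_diagram
      (G.comap (finiteSubfield p n).subtype.toAddMonoidHom)
    -- σ says that over every copy of the finite pair φ has a solution. It holds in all
    -- existentially closed models because the finite trace alone forces solvability in an
    -- extension.
    let σ : ringG.Sentence := Formula.iAlls (finiteSubfield p n)
      ((θ.imp (φ.exs.relabel b)).relabel Sum.inr)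
    have hσ (K : Type) [Field K] (H : AddSubgroup K) :
        PairModels H {σ} ↔ ∀ y : finiteSubfield p n → K, Sat H θ y default → ∃ a, Sat H φ (y ∘ b) a := by
      let := pairStructure H
      change K ⊨ ({σ} : ringG.Theory) ↔ _
      simp only [Theory.model_iff, Set.mem_singleton_iff, forall_eq, σ, Sentence.Realize]
      rw [Formula.realize_iAlls]
      refine forall_congr' fun y => ?_
      rw [Formula.realize_relabel, Formula.realize_imp, Formula.realize_relabel,
        BoundedFormula.realize_exs]
      rfl
    have hmem : σ ∈ theoryACFG p := by
      intro M inst hM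
      obtain ⟨_, _, _, H, rfl⟩ := exists_eq_pairStructure hM.1
      let := pairStructure H
      refine Theory.model_singleton_iff.1 ((hσ M H).2 fun y hy => ?_)
      obtain ⟨ι, rfl, hι⟩ := (hθ M H y).1 hy
      exact (isECModel_pairStructure_iff p H).1 hM k m φ hφ _ (h M H ι hι)
    have hGσ : PairModels G {σ} := by
      let := pairStructure G
      exact Theory.Model.mono (show Fpbar p ⊨ theoryACFG p from hG) (Set.singleton_subset_iff.2 hmem)
    exact (hσ _ G).1 hGσ (↑) ((hθ _ G _).2 ⟨(finiteSubfield p n).subtype, rfl, fun x => Iff.rfl⟩)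
  · intro h
    let := pairStructure G
    exact (Theory.model_iff _).2 fun σ hσ => hσ _ h

end Definability

/-! ### The Chabauty space and the Baire argument -/

section Topology

theorem isOpen_setOf_mem_iff {A : Type} [AddGroup A] (x : A) (P : Prop) :
    IsOpen {H : AddSubgroup A | x ∈ H ↔ P} := by
  by_cases hP : P
  · simp only [hP, iff_true]
    exact TopologicalSpace.isOpen_generateFrom_of_mem ⟨x, Or.inl rfl⟩
  · simp only [hP, iff_false]
    exact TopologicalSpace.isOpen_generateFrom_of_mem ⟨x, Or.inr rfl⟩

open Classical in
/-- The indicator map identifies the Chabauty space with a closed subspace of the Cantor space. -/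
theorem isClosedEmbedding_indicator (A : Type) [AddGroup A] :
    Topology.IsClosedEmbedding (fun (H : AddSubgroup A) (x : A) => decide (x ∈ H)) := by
  have hopen (x : A) (c : Bool) : IsOpen {g : A → Bool | g x = c} :=
    (isOpen_discrete {c}).preimage (f := fun g : A → Bool => g x) (continuous_apply x)
  have hcl (x : A) (c : Bool) : IsClosed {g : A → Bool | g x = c} :=
    (isClosed_discrete {c}).preimage (f := fun g : A → Bool => g x) (continuous_apply x)
  refine ⟨⟨⟨le_antisymm ?_ ?_⟩, ?_⟩, ?_⟩
  · rw [← continuous_iff_le_induced]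
    refine continuous_pi fun x => continuous_discrete_rng.2 fun c => ?_
    convert isOpen_setOf_mem_iff x (c = true) using 1
    ext H
    cases c <;> simp
  · refine le_generateFrom ?_
    rintro _ ⟨x, rfl | rfl⟩
    · exact ⟨_, hopen x true, by ext; simp⟩
    · exact ⟨_, hopen x false, by ext; simp⟩
  · intro H H' h
    ext x
    simpa using congrFun h x
  -- Each subgroup axiom constrains finitely many coordinates, hence is a closed condition.
  · have : Set.range (fun (H : AddSubgroup A) (x : A) => decide (x ∈ H)) =
        {g | g 0 = true} ∩ ((⋂ (x : A) (y : A),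
          ({g | g x = true}ᶜ ∪ ({g | g y = true}ᶜ ∪ {g | g (x + y) = true}))) ∩
        (⋂ x : A, ({g | g x = true}ᶜ ∪ {g | g (-x) = true}))) := by
      ext g
      simp only [Set.mem_range, Set.mem_inter_iff, Set.mem_iInter, Set.mem_union, Set.mem_compl_iff,
        Set.mem_ofPred_eq, ← imp_iff_not_or]
      constructor
      · rintro ⟨H, rfl⟩
        simp only [decide_eq_true_eq]
        exact ⟨H.zero_mem, fun x y => H.add_mem, fun x => H.neg_mem⟩
      · rintro ⟨h0, ha, hn⟩
        refine ⟨⟨⟨⟨{x | g x = true}, fun {x y} => ha x y⟩, h0⟩, fun {x} => hn x⟩, ?_⟩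
        funext x
        exact Bool.decide_eq_true
    rw [this]
    exact (hcl _ _).inter ((isClosed_iInter fun x => isClosed_iInter fun y =>
      (hopen _ _).isClosed_compl.union ((hopen _ _).isClosed_compl.union (hcl _ _))).inter
      (isClosed_iInter fun x => (hopen _ _).isClosed_compl.union (hcl _ _)))

instance compactSpace_chabauty (A : Type) [AddGroup A] : CompactSpace (AddSubgroup A) :=
  (isClosedEmbedding_indicator A).compactSpace

instance t2Space_chabauty (A : Type) [AddGroup A] : T2Space (AddSubgroup A) :=
  (isClosedEmbedding_indicator A).isEmbedding.t2Space

instance secondCountableTopology_chabauty (A : Type) [AddGroup A] [Countable A] :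
    SecondCountableTopology (AddSubgroup A) :=
  (isClosedEmbedding_indicator A).isEmbedding.secondCountableTopology

variable (p : ℕ) [Fact p.Prime]

instance countable_Fpbar : Countable (Fpbar p) := by
  have : Set.univ = ⋃ n : ℕ, (finiteSubfield p (n + 1) : Set (Fpbar p)) := by
    refine (Set.eq_univ_of_forall fun x => ?_).symm
    obtain ⟨n, hn, hx⟩ := exists_mem_finiteSubfield p x
    exact Set.mem_iUnion.2 ⟨n - 1, by rwa [Nat.sub_add_cancel hn]⟩
  rw [← Set.countable_univ_iff, this]
  exact Set.countable_iUnion fun n => (finite_finiteSubfield p n.succ_pos).countable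

instance countable_boundedFormula (α : Type) [Countable α] (m : ℕ) :
    Countable (ringG.BoundedFormula α m) := by
  have h1 (l : ℕ) : Countable (Language.ring.Functions l) :=
    Function.Injective.countable (β := Language.ring.Symbols) (f := fun g => Sum.inl ⟨l, g⟩)
      (Sum.inl_injective.comp sigma_mk_injective)
  have h2 (l : ℕ) : Countable (predLang.Functions l) := inferInstanceAs (Countable Empty)
  have h3 (l : ℕ) : Countable (Language.ring.Relations l) := inferInstanceAs (Countable Empty)
  have h4 (l : ℕ) : Countable (predLang.Relations l) :=
    have : Subsingleton (PredRel l) := ⟨by rintro ⟨⟩ ⟨⟩; rfl⟩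
    inferInstanceAs (Countable (PredRel l))
  have h5 (l : ℕ) : Countable (ringG.Functions l) :=
    inferInstanceAs (Countable (Language.ring.Functions l ⊕ predLang.Functions l))
  have h6 (l : ℕ) : Countable (ringG.Relations l) :=
    inferInstanceAs (Countable (Language.ring.Relations l ⊕ predLang.Relations l))
  have : Countable ringG.Symbols :=
    inferInstanceAs (Countable ((Σ l, ringG.Functions l) ⊕ (Σ l, ringG.Relations l)))
  exact Function.Injective.countable (f := fun φ => (⟨m, φ⟩ : Σ n, ringG.BoundedFormula α n))
    sigma_mk_injective

theorem isOpen_ball (H₀ : AddSubgroup (Fpbar p)) {n : ℕ} (hn : 1 ≤ n) : IsOpen (ball p H₀ n) := by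
  rw [chabautyTopology_eq_generateFrom_ball]
  exact TopologicalSpace.isOpen_generateFrom_of_mem ⟨H₀, n, hn, rfl⟩

/-- The balls around a point form a neighbourhood basis. -/
theorem exists_ball_subset {G : AddSubgroup (Fpbar p)} {U : Set (AddSubgroup (Fpbar p))}
    (hU : IsOpen U) (hG : G ∈ U) :
    ∃ n, 1 ≤ n ∧ ball p (G ⊓ (finiteSubfield p n).toAddSubgroup) n ⊆ U := by
  -- Balls shrink along divisibility, so two of them around G contain a third, with the product as
  -- index.
  have hmono {m n : ℕ} (h : m ∣ n) : ball p (G ⊓ (finiteSubfield p n).toAddSubgroup) n ⊆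
      ball p (G ⊓ (finiteSubfield p m).toAddSubgroup) m := by
    intro H (hH : _ = _)
    have hle : (finiteSubfield p m).toAddSubgroup ≤ (finiteSubfield p n).toAddSubgroup :=
      finiteSubfield_le_of_dvd p h
    change _ = _
    rw [← inf_eq_right.2 hle, ← inf_assoc, hH, inf_assoc]
  induction hU with
  | basic s hs =>
    obtain ⟨x, hx⟩ := hs
    obtain ⟨n, hn, hxn⟩ := exists_mem_finiteSubfield p x
    refine ⟨n, hn, fun H (hH : _ = _) => ?_⟩
    have : x ∈ H ↔ x ∈ G := by
      have := congrArg (x ∈ ·) hH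
      simpa [AddSubgroup.mem_inf, show x ∈ (finiteSubfield p n).toAddSubgroup from hxn] using this
    rcases hx with rfl | rfl
    · exact this.2 hG
    · exact mt this.1 hG
  | univ => exact ⟨1, le_rfl, Set.subset_univ _⟩
  | inter s t _ _ ihs iht =>
    obtain ⟨m, hm, hms⟩ := ihs hG.1
    obtain ⟨n, hn, hnt⟩ := iht hG.2
    exact ⟨m * n, Nat.mul_pos hm hn, Set.subset_inter
      ((hmono (dvd_mul_right m n)).trans hms) ((hmono (dvd_mul_left n m)).trans hnt)⟩
  | sUnion S _ ih =>
    obtain ⟨s, hs, hGs⟩ := hG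
    obtain ⟨n, hn, h⟩ := ih s hs hGs
    exact ⟨n, hn, h.trans (Set.subset_sUnion_of_mem hs)⟩

variable {p} {α : Type} {m : ℕ} {φ : ringG.BoundedFormula α m}

/-- A fixed solution survives as long as finitely many memberships are unchanged. -/
theorem isOpen_setOf_exists_sat (hφ : φ.IsQF) (b : α → Fpbar p) :
    IsOpen {G : AddSubgroup (Fpbar p) | ∃ a, Sat G φ b a} := by
  rw [isOpen_iff_forall_mem_open]
  rintro G ⟨a, ha⟩
  obtain ⟨S, hS⟩ := exists_finset_sat_iff hφ b a
  refine ⟨⋂ s ∈ S, {H | s ∈ H ↔ s ∈ G}, fun H hH => ⟨a, ?_⟩,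
    isOpen_biInter_finset fun s _ => isOpen_setOf_mem_iff s _, by simp⟩
  refine (hS _ _ G H (RingHom.id _) (RingHom.id _) fun s hs => ⟨Iff.rfl, ?_⟩).1 ha
  exact (Set.mem_iInter₂.1 hH s hs).symm

theorem isOpen_setOf_solvableInExtension [Finite α] (hφ : φ.IsQF) (b : α → Fpbar p) :
    IsOpen {G : AddSubgroup (Fpbar p) | SolvableInExtension G φ b} := by
  rw [isOpen_iff_forall_mem_open]
  intro G hG
  obtain ⟨n, hn, b', rfl, h⟩ := exists_finiteSubfield_solvable p hφ hG
  refine ⟨ball p (G ⊓ (finiteSubfield p n).toAddSubgroup) n, fun H (hH : _ = _) => ?_,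
    isOpen_ball p _ hn, rfl⟩
  refine h (Fpbar p) H (finiteSubfield p n).subtype fun x => ?_
  have := congrArg ((x : Fpbar p) ∈ ·) hH
  simpa [AddSubgroup.mem_inf, show (x : Fpbar p) ∈ (finiteSubfield p n).toAddSubgroup from x.2]
    using this

/-- The implication is the union of a closed and an open set, and closed sets are Gδ in a compact
Hausdorff second countable space. -/
theorem isGδ_setOf_solvable_imp [Finite α] (hφ : φ.IsQF) (b : α → Fpbar p) :
    IsGδ {G : AddSubgroup (Fpbar p) | SolvableInExtension G φ b → ∃ a, Sat G φ b a} := by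
  simp only [imp_iff_not_or]
  exact (isOpen_setOf_solvableInExtension hφ b).isClosed_compl.isGδ.union
    (isOpen_setOf_exists_sat hφ b).isGδ

theorem dense_setOf_solvable_imp (hφ : φ.IsQF) (b : α → Fpbar p) :
    Dense {G : AddSubgroup (Fpbar p) | SolvableInExtension G φ b → ∃ a, Sat G φ b a} := by
  rw [dense_iff_inter_open]
  rintro U hU ⟨G, hG⟩
  by_cases h : SolvableInExtension G φ b
  · obtain ⟨n, hn, hnU⟩ := exists_ball_subset p hU hG
    obtain ⟨H, hH, ha⟩ := exists_mem_ball_sat p hφ h hn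
    exact ⟨H, hnU hH, fun _ => ha⟩
  · exact ⟨G, hG, fun h' => absurd h' h⟩

variable (p)

theorem genericSubgroups_eq_iInter : genericSubgroups p =
    ⋂ (k : ℕ) (m : ℕ) (φ : {φ : ringG.BoundedFormula (Fin k) m // φ.IsQF}) (b : Fin k → Fpbar p),
      {G | SolvableInExtension G φ.1 b → ∃ a, Sat G φ.1 b a} := by
  ext G
  simp only [mem_genericSubgroups_iff, Set.mem_iInter, Subtype.forall]
  rfl

theorem isGδ_genericSubgroups : IsGδ (genericSubgroups p) := by
  rw [genericSubgroups_eq_iInter]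
  exact .iInter fun k => .iInter fun m => .iInter fun φ => .iInter fun b =>
    isGδ_setOf_solvable_imp φ.2 b

theorem dense_genericSubgroups : Dense (genericSubgroups p) := by
  rw [genericSubgroups_eq_iInter]
  have hG := fun (k m : ℕ) (φ : {φ : ringG.BoundedFormula (Fin k) m // φ.IsQF}) b =>
    isGδ_setOf_solvable_imp (p := p) φ.2 b
  -- Baire is applied once for each of the four countable indices.
  refine dense_iInter_of_Gδ (fun k => .iInter fun m => .iInter fun φ => .iInter fun b => hG k m φ b)
    fun k => dense_iInter_of_Gδ (fun m => .iInter fun φ => .iInter fun b => hG k m φ b)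
    fun m => dense_iInter_of_Gδ (fun φ => .iInter fun b => hG k m φ b)
    fun φ => dense_iInter_of_Gδ (fun b => hG k m φ b) fun b => dense_setOf_solvable_imp φ.2 b

/-- Every subgroup of a finite field is the trace of a generic subgroup. -/
theorem exists_genericSubgroup_inf_eq {n : ℕ} (hn : 1 ≤ n) {G₀ : AddSubgroup (Fpbar p)}
    (hG₀ : G₀ ≤ (finiteSubfield p n).toAddSubgroup) :
    ∃ G : AddSubgroup (Fpbar p), G ⊓ (finiteSubfield p n).toAddSubgroup = G₀ ∧
      G ∈ genericSubgroups p :=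
  (dense_genericSubgroups p).inter_open_nonempty _ (isOpen_ball p G₀ hn) ⟨G₀, inf_eq_left.2 hG₀⟩

end Topology

/-! ### Model companions and existentially closed models in general -/

section ModelCompanion

variable {L : FirstOrder.Language.{0, 0}} {M N P : Type} [L.Structure M] [L.Structure N]
  [L.Structure P]

/-- A formula that is preserved by embeddings. -/
def IsPreserved {α : Type} {n : ℕ} (φ : L.BoundedFormula α n) : Prop :=
  ∀ (M N : Type) [L.Structure M] [L.Structure N] (f : M ↪[L] N) (v : α → M) (xs : Fin n → M),
    φ.Realize v xs → φ.Realize (f ∘ v) (f ∘ xs)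

theorem isPreserved_of_isQF {α : Type} {n : ℕ} {φ : L.BoundedFormula α n} (h : φ.IsQF) :
    IsPreserved φ :=
  fun _ _ _ _ f _ _ => (h.realize_embedding f).2

theorem _root_.FirstOrder.Language.BoundedFormula.IsQF.realize_comp {α : Type} {ψ : L.Formula α}
    (h : ψ.IsQF) (f : M ↪[L] N) {v : α → M} (hv : ψ.Realize v) : ψ.Realize (f ∘ v) := by
  have := (h.realize_embedding f).2 hv
  rwa [Subsingleton.elim (f ∘ default) default] at this

theorem IsPreserved.ex {α : Type} {n : ℕ} {φ : L.BoundedFormula α (n + 1)} (h : IsPreserved φ) :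
    IsPreserved φ.ex := by
  intro M N _ _ f v xs hM
  obtain ⟨a, ha⟩ := BoundedFormula.realize_ex.1 hM
  refine BoundedFormula.realize_ex.2 ⟨f a, ?_⟩
  rw [← Fin.comp_snoc]
  exact h M N f v _ ha

/-- Embeddings reflect the quantifier-free premise. -/
theorem IsPreserved.imp {α : Type} {n : ℕ} {φ ψ : L.BoundedFormula α n} (hφ : φ.IsQF)
    (h : IsPreserved ψ) : IsPreserved (φ.imp ψ) :=
  fun M N _ _ f v xs hM hN => h M N f v xs (hM ((hφ.realize_embedding f).1 hN))

/-- Universal quantifications of formulas that are preserved by embeddings. -/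
inductive IsForallPreserved {α : Type} : ∀ {n : ℕ}, L.BoundedFormula α n → Prop
  | of {n : ℕ} {φ : L.BoundedFormula α n} (h : IsPreserved φ) : IsForallPreserved φ
  | all {n : ℕ} {φ : L.BoundedFormula α (n + 1)} (h : IsForallPreserved φ) :
      IsForallPreserved φ.all

theorem IsForallPreserved.alls {α : Type} {n : ℕ} {φ : L.BoundedFormula α n}
    (h : IsForallPreserved φ) : IsForallPreserved φ.alls := by
  induction n with
  | zero => exact h
  | succ n ih => exact ih h.all

/-- If `M ⊆ N ⊆ P` and `M` is an elementary substructure of `P`, then `∀∃` formulas go down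
from `N` to `M`. -/
theorem IsForallPreserved.realize_of_comp_elementary {α : Type} {n : ℕ}
    {φ : L.BoundedFormula α n} (hφ : IsForallPreserved φ) (f : M ↪[L] N) (g : N ↪[L] P)
    (e : M ↪ₑ[L] P) (he : ∀ x, e x = g (f x)) (v : α → M) (xs : Fin n → M)
    (h : φ.Realize (f ∘ v) (f ∘ xs)) : φ.Realize v xs := by
  induction hφ with
  | of hφ =>
    -- The matrix goes up from N to P and returns to M by elementarity.
    have := hφ N P g _ _ h
    rw [← e.map_boundedFormula]
    rwa [← Function.comp_assoc, ← Function.comp_assoc, ← show ⇑e = g ∘ f from funext he] at this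
  | all _ ih =>
    refine BoundedFormula.realize_all.2 fun a => ih _ ?_
    rw [Fin.comp_snoc]
    exact BoundedFormula.realize_all.1 h (f a)

theorem exists_isQF_realize_iff_forall {α : Type} {s : Set (L.Formula α)} (hs : s.Finite)
    (h : ∀ χ ∈ s, χ.IsQF) : ∃ ψ : L.Formula α, ψ.IsQF ∧
      ∀ (M : Type) [L.Structure M] (v : α → M), ψ.Realize v ↔ ∀ χ ∈ s, χ.Realize v := by
  induction s, hs using Set.Finite.induction_on with
  | empty => exact ⟨⊤, BoundedFormula.IsQF.top, fun M _ v => by simp⟩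
  | insert _ _ ih =>
    obtain ⟨ψ, hψ, hr⟩ := ih fun χ hχ => h χ (Set.mem_insert_of_mem _ hχ)
    refine ⟨_ ⊓ ψ, (h _ (Set.mem_insert _ _)).inf hψ, fun M _ v => ?_⟩
    simp [Formula.realize_inf, hr]

/-- In a model of a model complete theory, the truth of a formula is a consequence of the theory
and a single true quantifier-free formula. -/
theorem IsModelComplete.exists_isQF_imp {T : L.Theory} (hT : IsModelComplete T) [Nonempty N]
    (hN : N ⊨ T) (φ : L.Formula N) (hφ : φ.Realize (id : N → N)) :
    ∃ ψ : L.Formula N, ψ.IsQF ∧ ψ.Realize (id : N → N) ∧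
      ∀ (P : Type) [L.Structure P], P ⊨ T → ∀ ρ : N → P, ψ.Realize ρ → φ.Realize ρ := by
  by_contra! hcon
  let D : Set (L.Formula N) := {ψ | ψ.IsQF ∧ ψ.Realize (id : N → N)}
  -- T with the quantifier-free diagram of N and the negation of φ. Finite pieces have models by the
  -- assumption to be refuted, while a model of the whole is an extension of N, elementary by model
  -- completeness, where φ fails.
  let Θ : L[[N]].Theory := (L.lhomWithConstants N).onTheory T ∪
    (Formula.equivSentence '' D ∪ {Formula.equivSentence φ.not})
  have hsat : Θ.IsSatisfiable := by
    rw [Theory.isSatisfiable_iff_isFinitelySatisfiable]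
    intro T₀ hT₀
    obtain ⟨ψ, hψ, hr⟩ := exists_isQF_realize_iff_forall
      (s := {χ ∈ D | Formula.equivSentence χ ∈ T₀})
      ((T₀.finite_toSet.preimage Formula.equivSentence.injective.injOn).subset fun χ hχ => hχ.2)
      fun χ hχ => hχ.1.1
    obtain ⟨P, _, hP, ρ, hρ, hρ'⟩ := hcon ψ hψ ((hr N _).2 fun χ hχ => hχ.1.2)
    let : (constantsOn N).Structure P := constantsOn.structure ρ
    have : Nonempty P := Nonempty.map ρ ‹_›
    have hcon (a : N) : (L.con a : P) = ρ a := rfl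
    have : P ⊨ (T₀ : L[[N]].Theory) := by
      refine (Theory.model_iff _).2 fun σ hσ => ?_
      rcases hT₀ hσ with hσT | ⟨χ, hχ, rfl⟩ | rfl
      · exact ((LHom.onTheory_model _ T).2 hP).realize_of_mem σ hσT
      · exact (Formula.realize_equivSentence P χ).2 ((hr P ρ).1 hρ χ ⟨hχ, hσ⟩)
      · exact (Formula.realize_equivSentence P φ.not).2 (by simpa [hcon] using hρ')
    exact Theory.Model.isSatisfiable P
  obtain ⟨Q⟩ := hsat
  let : L.Structure Q := (L.lhomWithConstants N).reduct Q
  let ρ : N → Q := fun a => (L.con a : Q)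
  have hΘ := (Theory.model_iff Θ).1 Q.is_model
  have hD (ψ : L.Formula N) (hψ : ψ.IsQF) (h : ψ.Realize (id : N → N)) : ψ.Realize ρ :=
    (Formula.realize_equivSentence Q ψ).1 (hΘ _ (Or.inr (Or.inl ⟨ψ, ⟨hψ, h⟩, rfl⟩)))
  have hT' : (Q : Type) ⊨ T := by
    rw [← LHom.onTheory_model (L.lhomWithConstants N)]
    exact Theory.Model.mono Q.is_model Set.subset_union_left
  have hnot : ¬ φ.Realize ρ := Formula.realize_not.1 ((Formula.realize_equivSentence Q φ.not).1
    (hΘ _ (Or.inr (Or.inr rfl))))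
  have heq (t₁ t₂ : L.Term N) (h : t₁.realize (id : N → N) = t₂.realize id) :
      t₁.realize ρ = t₂.realize ρ :=
    Formula.realize_equal.1 (hD (t₁.equal t₂) (BoundedFormula.IsAtomic.equal _ _).isQF
      (Formula.realize_equal.2 h))
  let e : N ↪[L] Q :=
    { toFun := ρ
      inj' := by
        intro a b hab
        by_contra hne
        have := hD (∼((var a).equal (var b))) (BoundedFormula.IsAtomic.equal _ _).isQF.not
          (by simpa using hne)
        simp at this
        exact this hab
      map_fun' := fun f x => (heq (func f fun i => var (x i)) (var (Structure.funMap f x)) rfl).symm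
      map_rel' := by
        intro n R x
        have hQ : (R.formula fun i => (var (x i) : L.Term N)).IsQF :=
          (BoundedFormula.IsAtomic.rel _ _).isQF
        by_cases h : Structure.RelMap R x
        · have := hD _ hQ (Formula.realize_rel.2 h)
          exact iff_of_true (Formula.realize_rel.1 this) h
        · have := hD _ hQ.not (Formula.realize_not.2 (mt Formula.realize_rel.1 h))
          exact iff_of_false (fun h' => Formula.realize_not.1 this (Formula.realize_rel.2 h')) h }
  let e' : N ↪ₑ[L] Q := ⟨e, fun n ψ x => hT N Q hN hT' e n ψ x⟩
  exact hnot ((e'.map_formula φ id).2 hφ)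

/-- Existential closedness for formulas with arbitrary variables. -/
theorem IsECModel.exists_realize [Nonempty M] {T : L.Theory} (hM : IsECModel T M) (hN : N ⊨ T) (f : M ↪[L] N)
    {γ : Type} {ψ : L.Formula γ} (hψ : ψ.IsQF) (w : γ → N) (hw : ψ.Realize w) {k : ℕ}
    (b : Fin k → M) : ∃ ρ : γ → M, ψ.Realize ρ ∧ ∀ c i, w c = f (b i) → ρ c = b i := by
  classical
  let m := ψ.freeVarFinset.card
  let e := ψ.freeVarFinset.equivFin
  -- Variables with a value from b become parameters and the other free variables of ψ become
  -- unknowns. The rest of γ, possibly infinite, goes to one dummy unknown, whence m + 1.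
  let g : γ → Fin k ⊕ Fin (m + 1) := fun c =>
    if h : ∃ i, w c = f (b i) then Sum.inl h.choose
    else if h : c ∈ ψ.freeVarFinset then Sum.inr (e ⟨c, h⟩).castSucc else Sum.inr (Fin.last m)
  have hg {X : Type} (b : Fin k → X) (a : Fin (m + 1) → X) [L.Structure X] :
      (BoundedFormula.relabel g ψ).Realize b a ↔ ψ.Realize (Sum.elim b a ∘ g) := by
    rw [BoundedFormula.realize_relabel, Formula.Realize]
    exact iff_of_eq (congrArg _ (Subsingleton.elim _ _))
  have hdep {v v' : γ → N} (h : ∀ c ∈ ψ.freeVarFinset, v c = v' c) (hv : ψ.Realize v) :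
      ψ.Realize v' := by
    have h1 := BoundedFormula.realize_restrictFreeVar' (φ := ψ) subset_rfl (v := v)
      (xs := default)
    have h2 := BoundedFormula.realize_restrictFreeVar' (φ := ψ) subset_rfl (v := v')
      (xs := default)
    rw [show v' ∘ (Subtype.val : ↥(ψ.freeVarFinset : Set γ) → γ) = v ∘ Subtype.val from
      funext fun c => (h c c.2).symm] at h2
    exact h2.1 (h1.2 hv)
  obtain ⟨a, ha⟩ := hM.2 N hN f k (m + 1) (BoundedFormula.relabel g ψ) (hψ.relabel g) b
    ⟨fun j => Fin.lastCases (f (Classical.arbitrary M)) (fun j => w (e.symm j)) j, by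
      rw [hg]
      refine hdep (fun c hc => ?_) hw
      simp only [g, Function.comp_apply]
      split_ifs with h
      · exact h.choose_spec
      · simp⟩
  refine ⟨Sum.elim b a ∘ g, (hg b a).1 ha, fun c i hc => ?_⟩
  have h : ∃ i, w c = f (b i) := ⟨i, hc⟩
  simp only [g, Function.comp_apply, dif_pos h, Sum.elim_inl]
  exact f.injective (h.choose_spec.symm.trans hc)

/-- Existentially closed models are models of the model companion. -/
theorem IsModelCompanion.models_of_isECModel {T T' : L.Theory} (h : IsModelCompanion T T')
    [Nonempty M] (hM : IsECModel T M) : M ⊨ T' := by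
  obtain ⟨N, _, hN, ⟨f⟩⟩ := h.embeds M hM.1
  obtain ⟨N₁, _, hN₁, ⟨g⟩⟩ := h.embeds' N hN
  have : Nonempty N := Nonempty.map f ‹_›
  -- Tarski–Vaught: the truth of φ(f x, a) in N follows from T' and a quantifier-free ψ on elements
  -- of N. As N lies in a model N₁ of T, ψ can be solved in M with x kept fixed, and the value at a
  -- is the witness.
  let e : M ↪ₑ[L] N := f.toElementaryEmbedding fun n φ x a hφ => by
    let s : Fin (n + 1) → N := Fin.snoc (f ∘ x) a
    let φ' : L.Formula N := φ.toFormula.relabel (Sum.elim Empty.elim s)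
    have hφ' (ρ : N → N) : φ'.Realize ρ ↔ φ.Realize default (ρ ∘ s) := by
      simp only [φ', Formula.realize_relabel, BoundedFormula.realize_toFormula]
      exact iff_of_eq (congrArg₂ _ (Subsingleton.elim _ _) rfl)
    obtain ⟨ψ, hψ, hr, himp⟩ := h.modelComplete.exists_isQF_imp hN φ' ((hφ' id).2 hφ)
    obtain ⟨ρ, hρ, hρx⟩ := hM.exists_realize hN₁ (g.comp f) hψ g
      (hψ.realize_comp g hr) x
    refine ⟨ρ a, ?_⟩
    have h1 := (hφ' _).1 (himp N hN (f ∘ ρ) (hψ.realize_comp f hρ))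
    rw [Fin.comp_snoc] at h1
    rwa [show (f ∘ ρ) ∘ f ∘ x = f ∘ x from funext fun i => congrArg f (hρx _ i rfl)] at h1
  exact (e.theory_model_iff T').2 hN

/-- If the models of a model companion are models of the theory, they are existentially closed. -/
theorem IsModelCompanion.isECModel {T T' : L.Theory} (h : IsModelCompanion T T') (hM : M ⊨ T)
    (hM' : M ⊨ T') : IsECModel T M := by
  refine ⟨hM, fun N _ hN f k m φ hφ b ⟨a, ha⟩ => ?_⟩
  obtain ⟨P, _, hP, ⟨g⟩⟩ := h.embeds N hN
  -- The existential formula goes up to P and descends to M by model completeness.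
  have h1 : φ.exs.Realize (g.comp f ∘ b) :=
    BoundedFormula.realize_exs.2 ⟨g ∘ a, isPreserved_of_isQF hφ _ _ g _ _ ha⟩
  exact BoundedFormula.realize_exs.1 ((h.modelComplete M P hM' hP (g.comp f) k φ.exs b).1 h1)

end ModelCompanion

/-! ### Uniqueness of the model companion of `ACFsubG` -/

section Companion

variable (p : ℕ) [Fact p.Prime]

/-- The axioms are ∀∃: existentials occur only for inverses, a pair of distinct elements and roots
of polynomials. -/
theorem isForallPreserved_of_mem_ACF {σ : Language.ring.Sentence} (h : σ ∈ Theory.ACF p) :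
    IsForallPreserved σ := by
  have hp : p.Prime := Fact.out
  have heq {α : Type} {n : ℕ} (t₁ t₂ : Language.ring.Term (α ⊕ Fin n)) :
      (t₁.bdEqual t₂).IsQF := (BoundedFormula.IsAtomic.equal _ _).isQF
  simp only [Theory.ACF, Theory.fieldOfChar, hp.ne_zero, hp, if_true, if_false, Set.mem_union,
    Set.mem_singleton_iff, Set.mem_image] at h
  rcases h with (⟨ax, rfl⟩ | rfl) | ⟨n, -, rfl⟩
  · cases ax with
    | existsInv => exact .all (.of (.imp (heq _ _).not (isPreserved_of_isQF (heq _ _)).ex))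
    | existsPairNE => exact .of (isPreserved_of_isQF (heq _ _).not).ex.ex
    | zeroAdd => exact .all (.of (isPreserved_of_isQF (heq _ _)))
    | oneMul => exact .all (.of (isPreserved_of_isQF (heq _ _)))
    | negAddCancel => exact .all (.all (.of (isPreserved_of_isQF (heq _ _))))
    | mulComm => exact .all (.all (.of (isPreserved_of_isQF (heq _ _))))
    | addAssoc => exact .all (.all (.all (.of (isPreserved_of_isQF (heq _ _)))))
    | mulAssoc => exact .all (.all (.all (.of (isPreserved_of_isQF (heq _ _)))))
    | leftDistrib => exact .all (.all (.all (.of (isPreserved_of_isQF (heq _ _)))))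
  · exact .of (isPreserved_of_isQF (BoundedFormula.IsAtomic.equal _ _).isQF)
  · exact IsForallPreserved.alls (.of (isPreserved_of_isQF (heq _ _)).ex)

/-- Models of a model companion of `ACF_G` are models of `ACF_G`. -/
theorem models_ACFsubG_of_isModelCompanion {T : ringG.Theory}
    (h : IsModelCompanion (ACFsubG p) T) {M : Type} [ringG.Structure M] (hM : M ⊨ T) :
    M ⊨ ACFsubG p := by
  obtain ⟨N, _, hN, ⟨f⟩⟩ := h.embeds' M hM
  obtain ⟨P, _, hP, ⟨g⟩⟩ := h.embeds N hN
  -- M ⊆ N ⊆ P with M elementary in P, so the ∀∃ field axioms descend from N to M; the axioms on the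
  -- subgroup are universal and pass to substructures.
  let e : M ↪ₑ[ringG] P := ⟨g.comp f, fun n φ x => h.modelComplete M P hM hP (g.comp f) n φ x⟩
  obtain ⟨hN1, hN2⟩ := Theory.model_union_iff.1 hN
  refine Theory.model_union_iff.2 ⟨?_, ?_⟩
  · let ϕ : Language.ring →ᴸ ringG := LHom.sumInl
    let := ϕ.reduct M
    let := ϕ.reduct N
    let := ϕ.reduct P
    rw [LHom.onTheory_model] at hN1 ⊢
    let f' : M ↪[Language.ring] N := ⟨f.toEmbedding, fun F x => f.map_fun (ϕ.onFunction F) x,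
      fun R x => f.map_rel (ϕ.onRelation R) x⟩
    let g' : N ↪[Language.ring] P := ⟨g.toEmbedding, fun F x => g.map_fun (ϕ.onFunction F) x,
      fun R x => g.map_rel (ϕ.onRelation R) x⟩
    let e' : M ↪ₑ[Language.ring] P := ⟨e, fun n φ x => by
      have := e.map_formula (ϕ.onFormula φ) x
      rwa [LHom.realize_onFormula, LHom.realize_onFormula] at this⟩
    refine (Theory.model_iff _).2 fun σ hσ => ?_
    refine (isForallPreserved_of_mem_ACF p hσ).realize_of_comp_elementary f' g' e' (fun _ => rfl)
      default default ?_
    rw [Subsingleton.elim (f' ∘ default) default, Subsingleton.elim (f' ∘ default) default]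
    exact hN1.realize_of_mem σ hσ
  · have : N ⊨ ({axiomZero, axiomAdd, axiomNeg} : ringG.Theory) := hN2
    have hrel (n : ℕ) (t : ringG.Term (Empty ⊕ Fin n)) : (symG.boundedFormula₁ t).IsQF :=
      (BoundedFormula.IsAtomic.rel _ _).isQF
    have : ({axiomZero, axiomAdd, axiomNeg} : ringG.Theory).IsUniversal := ⟨by
      rintro _ (rfl | rfl | rfl)
      · exact (hrel _ _).isUniversal
      · exact ((hrel _ _).imp ((hrel _ _).imp (hrel _ _))).isUniversal.all.all
      · exact ((hrel _ _).imp (hrel _ _)).isUniversal.all⟩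
    exact Theory.IsUniversal.models_of_embedding f

/-- The models of a model companion of `ACF_G` are the models of `ACFG`. -/
theorem models_iff_models_theoryACFG {T : ringG.Theory}
    (h : IsModelCompanion (ACFsubG p) T) (M : Type) [ringG.Structure M] :
    M ⊨ T ↔ M ⊨ theoryACFG p := by
  constructor
  · intro hM
    have hec := h.isECModel (models_ACFsubG_of_isModelCompanion p h hM) hM
    exact (Theory.model_iff _).2 fun σ hσ => hσ M hec
  -- Each sentence of T holds in all existentially closed models, hence belongs to ACFG.
  · refine fun hM => Theory.Model.mono hM fun σ hσ N _ hN => ?_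
    have : Nonempty N := ⟨Structure.funMap (L := ringG) (Sum.inl .zero : ringG.Functions 0) Fin.elim0⟩
    exact (h.models_of_isECModel hN).realize_of_mem σ hσ

end Companion

end ACFG

theorem mainTheorem8 (p : ℕ) [Fact p.Prime] :
    -- the generic subgroups form a dense Gδ set
    (IsGδ (ACFG.genericSubgroups p) ∧ Dense (ACFG.genericSubgroups p)) ∧
    -- every subgroup of a finite field extends to a generic subgroup with the same trace
    (∀ n : ℕ, 1 ≤ n → ∀ G₀ : AddSubgroup (ACFG.Fpbar p),
      G₀ ≤ (ACFG.finiteSubfield p n).toAddSubgroup →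
        ∃ G : AddSubgroup (ACFG.Fpbar p),
          G ⊓ (ACFG.finiteSubfield p n).toAddSubgroup = G₀ ∧ G ∈ ACFG.genericSubgroups p) ∧
    -- every model companion of `ACF_G` has the same models as `ACFG`
    (∀ T : ACFG.ringG.Theory, ACFG.IsModelCompanion (ACFG.ACFsubG p) T →
      ∀ (M : Type) [ACFG.ringG.Structure M], M ⊨ T ↔ M ⊨ ACFG.theoryACFG p) :=
  ⟨⟨ACFG.isGδ_genericSubgroups p, ACFG.dense_genericSubgroups p⟩,
    fun _ hn _ hG₀ => ACFG.exists_genericSubgroup_inf_eq p hn hG₀,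
    fun _ hT M _ => ACFG.models_iff_models_theoryACFG p hT M⟩
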